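/- Let $q$ be a power of an odd prime, let $r$ be an odd positive integer with $q\ge r+1$, and let $V$ be a vector space of dimension $n=2r$ over $\mathbb{F}_q$. For a symmetric bilinear form $f$ on $V\times V$ let $\operatorname{rad} f=\{u\in V: f(u,v)=0 \text{ for all } v\in V\}$ be its radical and $\operatorname{rank} f=n-\dim\operatorname{rad} f$ its rank. Let $\mathcal{M}$ be a $3r$-dimensional subspace of the space $\operatorname{Symm}(V)$ of symmetric bilinear forms on $V\times V$ in which every non-zero element has rank $r$ or $2r$. For non-zero $u\in V$ put $\mathcal{M}_u=\{f\in\mathcal{M}: u\in\operatorname{rad} f\}$. A constant rank $r$ subspace is a non-zero subspace all of whose non-zero elements have rank $r$. Then the following hold. 1. For every non-zero $u\in V$, $\mathcal{M}_u$ is an $r$-dimensional constant rank $r$ subspace, and all non-zero elements of $\mathcal{M}_u$ have the same $r$-dimensional radical. 2. For all non-zero $u,w\in V$, either $\mathcal{M}_u=\mathcal{M}_w$ or $\mathcal{M}_u\cap\mathcal{M}_w=0$. 3. The radicals of the non-zero elements of the subspaces $\mathcal{M}_u$ ($0\ne u\in V$) form a spread of $V$ consisting of exactly $q^r+1$ subspaces;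 that is, they are $r$-dimensional, any two different ones intersect trivially, and they cover $V$. 4. There are exactly $q^r+1$ different subspaces $\mathcal{M}_u$ ($0\neq u\in V$), and they are exactly the $r$-dimensional constant rank $r$ subspaces of $\mathcal{M}$. 5. If $u,w\in V$ are non-zero and $\mathcal{M}_u\ne\mathcal{M}_w$, then the sum $\mathcal{M}_u\oplus\mathcal{M}_w$ is direct, has dimension $2r$, and contains no elements of rank $r$ other than those in $\mathcal{M}_u$ or $\mathcal{M}_w$. Moreover, for every $r$-dimensional constant rank $r$ subspace $\mathcal{N}$ of $\mathcal{M}$ different from $\mathcal{M}_u$ and $\mathcal{M}_w$, \[ (\mathcal{M}_u\oplus\mathcal{M}_w)\cap\mathcal{N}=0,\qquad \mathcal{M}=\mathcal{M}_u\oplus\mathcal{M}_w\oplus\mathcal{N}. \] -/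

import Mathlib

open Module

namespace SymmForms

variable {K V : Type*} [Field K] [AddCommGroup V] [Module K V]

/-- The space of symmetric bilinear forms on `V × V`. -/
def Symm (K V : Type*) [Field K] [AddCommGroup V] [Module K V] :
    Submodule K (LinearMap.BilinForm K V) where
  carrier := {f | f.IsSymm}
  add_mem' hf hg := hf.add hg
  zero_mem' := LinearMap.BilinForm.isSymm_zero
  smul_mem' c _ hf := hf.smul c

/-- The (left) radical of `f`: all `u` with `f u v = 0` for all `v`. For symmetric `f` the left
and right radicals agree. -/
def rad (f : LinearMap.BilinForm K V) : Submodule K V where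
  carrier := {u | ∀ v, f u v = 0}
  add_mem' ha hb v := by simp [ha v, hb v]
  zero_mem' v := by simp
  smul_mem' c _ hu v := by simp [hu v]

/-- The rank of `f`: the codimension of its radical (`V` is finite-dimensional in all uses). -/
noncomputable def rank (f : LinearMap.BilinForm K V) : ℕ :=
  finrank K V - finrank K (rad f)

/-- `sub M u` is the subspace of all forms in `M` whose radical contains `u`. -/
def sub (M : Submodule K (LinearMap.BilinForm K V)) (u : V) :
    Submodule K (LinearMap.BilinForm K V) where
  carrier := {f | f ∈ M ∧ u ∈ rad f}
  add_mem' ha hb := ⟨M.add_mem ha.1 hb.1, fun v => by simp [ha.2 v, hb.2 v]⟩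
  zero_mem' := ⟨M.zero_mem, fun v => by simp⟩
  smul_mem' c _ hf := ⟨M.smul_mem c hf.1, fun v => by simp [hf.2 v]⟩

/-- A constant rank `r` subspace: a nonzero subspace all of whose nonzero elements have
rank `r`. -/
def IsConstantRank (r : ℕ) (N : Submodule K (LinearMap.BilinForm K V)) : Prop :=
  N ≠ ⊥ ∧ ∀ f ∈ N, f ≠ 0 → rank f = r

/-- A spread of `r`-dimensional subspaces of `V`: pairwise trivially intersecting
`r`-dimensional subspaces that cover `V`. -/
def IsSpread (r : ℕ) (S : Set (Submodule K V)) : Prop :=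
  (∀ U ∈ S, finrank K U = r) ∧
  (∀ U ∈ S, ∀ W ∈ S, U ≠ W → U ⊓ W = ⊥) ∧
  ∀ v : V, ∃ U ∈ S, v ∈ U

/-- The set of the subspaces `sub M u`, for nonzero `u`. -/
def subs (M : Submodule K (LinearMap.BilinForm K V)) :
    Set (Submodule K (LinearMap.BilinForm K V)) :=
  {N | ∃ u : V, u ≠ 0 ∧ N = sub M u}

/-- The set of the radicals of the nonzero elements of the subspaces `sub M u`, `u` nonzero. -/
def radicals (M : Submodule K (LinearMap.BilinForm K V)) : Set (Submodule K V) :=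
  {U | ∃ u : V, u ≠ 0 ∧ ∃ f ∈ sub M u, f ≠ 0 ∧ U = rad f}

end SymmForms

/-! The crux is `finrank_eq_and_rad_eq`: a space `N` of symmetric forms of constant odd rank `r`,
with `dim N ≥ r`, has dimension `r` and a single radical. Two estimates of the set `Z` of common
isotropic vectors of `N` give this. Multiplication by a nonsquare negates the exponential sum of a
form of odd rank, so the nonzero forms contribute nothing in total and `|N| |Z| = |V|`
(`card_mul_ncard_commonIsotropic`). A determinant argument on pencils, which needs `q ≥ r + 1`, puts
`rad f` inside `Z` for every nonzero `f` in `N` (`apply_self_eq_zero_of_mem_rad`). Hence `q ^ r ≤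
|Z| = q ^ (2r - dim N)`, which forces `dim N = r` and `rad f = Z`.

Evaluation at `u ≠ 0` maps `M` to the dual of `V`, so `dim M_u ≥ 3r - 2r = r`, and rank `2r` is
impossible in `M_u`; the crux applies. The rest is formal: the common radicals partition the nonzero
vectors, and two nonzero forms with complementary radicals have a nondegenerate sum, which controls
the rank `r` elements of `M_u ⊕ M_w`. -/

namespace SymmForms

section MonoidStructure

/-! Dimension facts over a field for modules whose addition is only given as a monoid structure;
instance search does not find the group structure on subspaces of `LinearMap.BilinForm K V`. -/

variable {K E : Type*} [Field K] [AddCommMonoid E] [Module K E]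

theorem natCard_eq_pow_finrank_of_monoid [Module.Finite K E] :
    Nat.card E = Nat.card K ^ finrank K E :=
  let := Module.addCommMonoidToAddCommGroup (M := E) K
  natCard_eq_pow_finrank

theorem eq_of_le_of_finrank_le_of_monoid [Module.Finite K E] {S T : Submodule K E} (hle : S ≤ T)
    (h : finrank K T ≤ finrank K S) : S = T :=
  let := Module.addCommMonoidToAddCommGroup (M := E) K
  Submodule.eq_of_le_of_finrank_le hle h

theorem finrank_sup_of_monoid [Module.Finite K E] {S T : Submodule K E} (h : S ⊓ T = ⊥) :
    finrank K ↥(S ⊔ T) = finrank K S + finrank K T := by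
  let := Module.addCommMonoidToAddCommGroup (M := E) K
  rw [← Submodule.finrank_sup_add_finrank_inf_eq, h, finrank_bot, add_zero]

theorem finrank_range_add_finrank_ker_of_monoid {F : Type*} [AddCommMonoid F] [Module K F]
    [Module.Finite K E] (φ : E →ₗ[K] F) :
    finrank K (LinearMap.range φ) + finrank K (LinearMap.ker φ) = finrank K E := by
  let := Module.addCommMonoidToAddCommGroup (M := E) K
  let := Module.addCommMonoidToAddCommGroup (M := F) K
  exact LinearMap.finrank_range_add_finrank_ker φ
end MonoidStructure

/-! ### Rank, radical and Gram matrices. -/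

variable {K V : Type*} [Field K] [AddCommGroup V] [Module K V]

theorem mem_rad {f : LinearMap.BilinForm K V} {u : V} : u ∈ rad f ↔ ∀ v, f u v = 0 := Iff.rfl

theorem mem_sub {M : Submodule K (LinearMap.BilinForm K V)} {u : V}
    {f : LinearMap.BilinForm K V} : f ∈ sub M u ↔ f ∈ M ∧ u ∈ rad f := Iff.rfl

theorem rad_eq_ker (f : LinearMap.BilinForm K V) : rad f = LinearMap.ker f := by
  ext u
  simp [mem_rad, LinearMap.ext_iff]

theorem rank_add_finrank_rad [FiniteDimensional K V] (f : LinearMap.BilinForm K V) :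
    rank f + finrank K (rad f) = finrank K V :=
  Nat.sub_add_cancel (Submodule.finrank_le _)

theorem rank_eq_finrank_range [FiniteDimensional K V] (f : LinearMap.BilinForm K V) :
    rank f = finrank K (LinearMap.range f) := by
  have h := LinearMap.finrank_range_add_finrank_ker f
  rw [← rad_eq_ker] at h
  have := rank_add_finrank_rad f
  omega

theorem rank_zero [FiniteDimensional K V] : rank (0 : LinearMap.BilinForm K V) = 0 := by
  simp [rank_eq_finrank_range]

/-- The Gram matrix of a family of vectors with respect to a bilinear form. -/
def gram {ι : Type*} (f : LinearMap.BilinForm K V) (v : ι → V) : Matrix ι ι K :=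
  Matrix.of fun i j => f (v i) (v j)

/-- A nonsingular Gram matrix of size `m` forces the rank of the form to be at least `m`. -/
theorem card_le_rank_of_det_gram_ne_zero [FiniteDimensional K V] {ι : Type*} [Fintype ι]
    [DecidableEq ι] {f : LinearMap.BilinForm K V} {v : ι → V} (h : (gram f v).det ≠ 0) :
    Fintype.card ι ≤ rank f := by
  have hli : LinearIndependent K fun i => f (v i) := by
    rw [Fintype.linearIndependent_iff]
    intro c hc
    have h0 : Matrix.vecMul c (gram f v) = 0 := by
      funext j
      have := LinearMap.congr_fun hc (v j)
      simpa [Matrix.vecMul, dotProduct, gram, LinearMap.sum_apply] using this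
    exact congrFun (Matrix.eq_zero_of_vecMul_eq_zero h h0)
  rw [rank_eq_finrank_range, ← finrank_span_eq_card hli]
  refine Submodule.finrank_mono (Submodule.span_le.mpr ?_)
  rintro _ ⟨i, rfl⟩
  exact LinearMap.mem_range_self f (v i)

/-- A symmetric form of rank `r` has a nonsingular Gram matrix of size `r`. -/
theorem exists_det_gram_ne_zero [FiniteDimensional K V] {f : LinearMap.BilinForm K V}
    (hf : f.IsSymm) : ∃ v : Fin (rank f) → V, (gram f v).det ≠ 0 := by
  obtain ⟨W, hW⟩ := Submodule.exists_isCompl (rad f)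
  have hdim : finrank K W = rank f := by
    have := Submodule.finrank_add_eq_of_isCompl hW
    have := rank_add_finrank_rad f
    omega
  let b := finBasisOfFinrankEq K W hdim
  refine ⟨fun i => b i, fun hdet => ?_⟩
  obtain ⟨c, hc0, hc⟩ := Matrix.exists_vecMul_eq_zero_iff.mpr hdet
  let x : W := ∑ i, c i • b i
  have hxb : ∀ j, f x (b j) = 0 := by
    intro j
    have := congrFun hc j
    simpa [x, Matrix.vecMul, dotProduct, gram, LinearMap.sum_apply] using this
  have hxW : ∀ w : W, f x w = 0 := by
    have : (f x).comp W.subtype = 0 := b.ext fun j => by simpa using hxb j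
    exact fun w => LinearMap.congr_fun this w
  have hx : (x : V) ∈ rad f := by
    intro v
    obtain ⟨y, hy, z, hz, rfl⟩ := Submodule.mem_sup.mp (hW.sup_eq_top ▸ Submodule.mem_top (x := v))
    rw [map_add, hf.eq, hy, hxW ⟨z, hz⟩, add_zero]
  have hx0 : x = 0 := by
    have := (Submodule.disjoint_def.mp hW.disjoint) _ hx x.2
    exact_mod_cast this
  exact hc0 (funext (Fintype.linearIndependent_iff.mp b.linearIndependent c hx0))

/-! ### Pencils of forms of bounded rank. -/

/-- If a pencil of matrices of size `r` is singular at infinity and at every nonzero scalar, and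
there are at least `r` nonzero scalars, then it is singular at zero. -/
theorem det_eq_zero_of_pencil [Finite K] {r : ℕ} (hq : r + 1 ≤ Nat.card K)
    {A B : Matrix (Fin r) (Fin r) K} (hr : 0 < r) (hB : B.det = 0)
    (h : ∀ t : K, t ≠ 0 → (t • B + A).det = 0) : A.det = 0 := by
  classical
  have := Fintype.ofFinite K
  open Polynomial in
  let p : K[X] := ((X : K[X]) • B.map C + A.map C).det
  have hp : p = 0 := by
    -- The coefficient of `X ^ r` is `det B = 0`, so the `q - 1 ≥ r` nonzero scalars are too many
    -- roots.
    have hdeg : p.natDegree < r := by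
      refine lt_of_le_of_ne (by simpa using Polynomial.natDegree_det_X_add_C_le B A) fun he => ?_
      have hc := Polynomial.coeff_det_X_add_C_card B A
      rw [Fintype.card_fin, hB] at hc
      have : p.leadingCoeff = 0 := by rw [Polynomial.leadingCoeff, he]; exact hc
      rw [Polynomial.leadingCoeff_eq_zero] at this
      rw [this, Polynomial.natDegree_zero] at he
      omega
    refine Polynomial.eq_zero_of_natDegree_lt_card_of_eval_eq_zero' p
      (Finset.univ.erase 0) (fun t ht => ?_) ?_
    · rw [← h t (Finset.ne_of_mem_erase ht)]
      rw [← Polynomial.coe_evalRingHom, RingHom.map_det]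
      congr 1
      ext i j
      simp only [RingHom.mapMatrix_apply, Matrix.map_apply, Matrix.add_apply, Matrix.smul_apply,
        smul_eq_mul, map_add, Polynomial.coe_evalRingHom, Polynomial.eval_mul,
        Polynomial.eval_X, Polynomial.eval_C]
    · rw [Finset.card_erase_of_mem (Finset.mem_univ _), Finset.card_univ,
        ← Nat.card_eq_fintype_card]
      omega
  rw [← Polynomial.coeff_det_X_add_C_zero B A]
  exact (congrArg (fun s => Polynomial.coeff s 0) hp).trans (Polynomial.coeff_zero 0)

/-- In a pencil of symmetric forms of rank at most `r = rank f`, the radical of `f` is isotropic. -/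
theorem apply_self_eq_zero_of_mem_rad [Finite K] [FiniteDimensional K V]
    {f g : LinearMap.BilinForm K V} (hf : f.IsSymm) (hg : g.IsSymm)
    (hr : 0 < rank f) (hq : rank f + 1 ≤ Nat.card K) (hgr : rank g ≤ rank f)
    (hfg : ∀ t : K, rank (t • g + f) ≤ rank f) {u : V} (hu : u ∈ rad f) : g u u = 0 := by
  by_contra hb
  obtain ⟨e, he⟩ := exists_det_gram_ne_zero hf
  -- Each `e i` is made `g`-orthogonal to `u`; as `u` lies in `rad f`, the Gram matrix of `f` is
  -- unchanged.
  let w : Fin (rank f) → V := fun i => e i - (g u (e i) / g u u) • u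
  have hfu : ∀ v, f v u = 0 := fun v => by rw [hf.eq]; exact hu v
  have hgw : ∀ i, g u (w i) = 0 := fun i => by simp [w, hb]
  have hfw : gram f w = gram f e := by
    ext i j
    simp [gram, w, hfu, hu _]
  -- Otherwise `u` and the `w i` would give a nonsingular Gram matrix of size `rank f + 1`.
  have key : ∀ h : LinearMap.BilinForm K V, h.IsSymm → h u u ≠ 0 → (∀ i, h u (w i) = 0) →
      rank h ≤ rank f → (gram h w).det = 0 := by
    intro h hs huu huw hle
    by_contra hd
    have hG : gram h (Sum.elim (fun _ : Unit => u) w) =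
        Matrix.fromBlocks (Matrix.of fun _ _ => h u u) 0 0 (gram h w) := by
      ext i j
      rcases i with i | i <;> rcases j with j | j <;> simp [gram, huw]
      rw [hs.eq, huw]
    have hdet : (gram h (Sum.elim (fun _ : Unit => u) w)).det ≠ 0 := by
      rw [hG, Matrix.det_fromBlocks_zero₂₁]
      exact mul_ne_zero (by simpa using huu) hd
    have := card_le_rank_of_det_gram_ne_zero hdet
    simp at this
    omega
  apply he
  rw [← hfw]
  -- `key` does not apply at `t = 0`, since `f u u = 0`; that case is what the pencil lemma
  -- supplies.
  refine det_eq_zero_of_pencil hq hr (key g hg hb hgw hgr) fun t ht => ?_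
  have hadd : t • gram g w + gram f w = gram (t • g + f) w := by
    ext i j
    simp [gram]
  rw [hadd]
  refine key _ ((hg.smul t).add hf) ?_ (fun i => ?_) (hfg t)
  · simpa [hu u] using ⟨ht, hb⟩
  · simp [hgw, hu _]

/-- The rank of a form with an orthogonal basis is the number of non-isotropic basis vectors. -/
theorem rank_eq_card_of_isOrtho [FiniteDimensional K V] {ι : Type*} [Fintype ι]
    [DecidableEq K] {f : LinearMap.BilinForm K V} (b : Basis ι K V) (hb : f.IsOrthoᵢ b) :
    rank f = Fintype.card {i // f (b i) (b i) ≠ 0} := by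
  classical
  rw [← Matrix.rank_diagonal, rank_eq_finrank_range,
    Matrix.rank_eq_finrank_range_toLin _ b.dualBasis b]
  suffices h : f = Matrix.toLin b b.dualBasis (Matrix.diagonal fun i => f (b i) (b i)) by
    rw [← h]
  refine b.ext fun i => b.ext fun j => ?_
  rw [Matrix.toLin_self]
  rcases eq_or_ne i j with rfl | hij
  · simp [Matrix.diagonal_apply]
  · rw [show f (b i) (b j) = 0 from hb hij]
    simp [Matrix.diagonal_apply, hij.symm]

/-! ### Exponential sums of symmetric forms. -/

section CharacterSums

variable {ψ : AddChar K ℂ}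

theorem char_sum_eq_prod {ι : Type*} (s : Finset ι) (a : ι → K) :
    ψ (∑ i ∈ s, a i) = ∏ i ∈ s, ψ (a i) := by
  classical
  induction s using Finset.induction_on with
  | empty => simp
  | insert i s hi ih => rw [Finset.sum_insert hi, Finset.prod_insert hi, AddChar.map_add_eq_mul, ih]

/-- A nontrivial character sums to zero along a nonzero linear functional. -/
theorem sum_char_comp_eq_zero {E : Type*} [AddCommMonoid E] [Module K E] [Fintype E]
    (hψ : ψ 1 ≠ 1) {φ : E →ₗ[K] K} (hφ : φ ≠ 0) : ∑ x, ψ (φ x) = 0 := by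
  let := Module.addCommMonoidToAddCommGroup (M := E) K
  obtain ⟨e, he⟩ := DFunLike.ne_iff.mp hφ
  refine AddChar.sum_eq_zero_of_ne_one (ψ := ψ.compAddMonoidHom φ.toAddMonoidHom) fun h => hψ ?_
  have := DFunLike.congr_fun h ((φ e)⁻¹ • e)
  simpa [inv_mul_cancel₀ he] using this

variable [Fintype K]

theorem sum_char_mul_eq_zero (hψ : ψ 1 ≠ 1) {a : K} (ha : a ≠ 0) : ∑ x, ψ (a * x) = 0 :=
  sum_char_comp_eq_zero hψ (φ := LinearMap.mul K K a) fun h => ha (by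
    simpa using LinearMap.congr_fun h 1)

/-- Each `y` has `χ(y) + 1` square roots, `χ` the quadratic character, and the constant term sums to
zero. -/
theorem sum_char_mul_sq [DecidableEq K] (hK : ringChar K ≠ 2) (hψ : ψ 1 ≠ 1) {a : K} (ha : a ≠ 0) :
    ∑ x, ψ (a * x ^ 2) = ∑ y, (quadraticChar K y : ℂ) * ψ (a * y) := by
  have h : ∑ x, ψ (a * x ^ 2) = ∑ y, ((quadraticChar K y : ℂ) + 1) * ψ (a * y) := by
    rw [← Finset.sum_fiberwise Finset.univ (fun x : K => x ^ 2)]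
    refine Finset.sum_congr rfl fun y _ => ?_
    have hc := quadraticChar_card_sqrts hK y
    rw [Finset.sum_congr rfl (g := fun _ => ψ (a * y))
      (fun x hx => by rw [(Finset.mem_filter.mp hx).2]), Finset.sum_const, nsmul_eq_mul]
    congr 1
    have hc' := congrArg (Int.cast : ℤ → ℂ) hc
    push_cast at hc'
    rw [← hc']
    congr 2
    ext x
    simp
  rw [h]
  simp only [add_mul, one_mul, Finset.sum_add_distrib, sum_char_mul_eq_zero hψ ha, add_zero]

/-- Substituting `y ↦ ε * y` in the Gauss sum brings out the factor `χ(ε) = -1`. -/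
theorem sum_char_nonsquare_mul_sq (hK : ringChar K ≠ 2) (hψ : ψ 1 ≠ 1) {ε : K}
    (hε : ¬ IsSquare ε) {a : K} (ha : a ≠ 0) :
    ∑ x, ψ (ε * a * x ^ 2) = -∑ x, ψ (a * x ^ 2) := by
  classical
  have hε0 : ε ≠ 0 := by rintro rfl; exact hε IsSquare.zero
  rw [sum_char_mul_sq hK hψ (mul_ne_zero hε0 ha), sum_char_mul_sq hK hψ ha,
    ← Equiv.sum_comp (Equiv.mulLeft₀ ε hε0) fun y => (quadraticChar K y : ℂ) * ψ (a * y),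
    ← Finset.sum_neg_distrib]
  refine Finset.sum_congr rfl fun y _ => ?_
  have h := quadraticChar_neg_one_iff_not_isSquare.mpr hε
  simp only [Equiv.mulLeft₀_apply, map_mul, h]
  push_cast
  rw [show ε * a * y = a * (ε * y) by ring]
  ring

/-- The exponential sum of a form. -/
noncomputable def expSum [Fintype V] (ψ : AddChar K ℂ) (f : LinearMap.BilinForm K V) : ℂ :=
  ∑ v, ψ (f v v)

/-- In orthogonal coordinates the form is diagonal, so its sum splits into one-variable sums. -/
theorem expSum_eq_prod [Fintype V] {ι : Type*} [Fintype ι] {f : LinearMap.BilinForm K V}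
    (b : Basis ι K V) (hb : f.IsOrthoᵢ b) :
    expSum ψ f = ∏ i, ∑ x, ψ (f (b i) (b i) * x ^ 2) := by
  classical
  rw [Fintype.prod_sum, expSum, ← Equiv.sum_comp b.equivFun.symm.toEquiv]
  refine Finset.sum_congr rfl fun c _ => ?_
  rw [← char_sum_eq_prod]
  congr 1
  simp only [LinearEquiv.coe_toEquiv, Basis.equivFun_symm_apply, map_sum, LinearMap.sum_apply,
    map_smul, LinearMap.smul_apply, smul_eq_mul]
  refine Finset.sum_congr rfl fun i _ => ?_
  rw [Finset.sum_eq_single i]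
  · ring
  · intro j _ hj
    rw [show f (b j) (b i) = 0 from hb hj]
    simp
  · simp

/-- Scaling a symmetric form of odd rank by a nonsquare negates its exponential sum. -/
theorem expSum_nonsquare_smul [Fintype V] [FiniteDimensional K V] (hK : ringChar K ≠ 2)
    (hψ : ψ 1 ≠ 1) {ε : K} (hε : ¬ IsSquare ε) {f : LinearMap.BilinForm K V} (hf : f.IsSymm)
    (hodd : Odd (rank f)) : expSum ψ (ε • f) = -expSum ψ f := by
  classical
  have : Invertible (2 : K) := invertibleOfNonzero (Ring.two_ne_zero hK)
  obtain ⟨b, hb⟩ := LinearMap.BilinForm.exists_orthogonal_basis ⟨hf.eq⟩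
  have hb' : (ε • f).IsOrthoᵢ b := fun i j hij => by
    have h : f (b i) (b j) = 0 := hb hij
    simp [Function.onFun, h]
  have hterm : ∀ i, ∑ x, ψ ((ε • f) (b i) (b i) * x ^ 2) =
      (if f (b i) (b i) ≠ 0 then -1 else 1) * ∑ x, ψ (f (b i) (b i) * x ^ 2) := by
    intro i
    split_ifs with h
    · rw [neg_one_mul, ← sum_char_nonsquare_mul_sq hK hψ hε h]
      simp
    · rw [not_not] at h
      simp [h]
  rw [expSum_eq_prod b hb', expSum_eq_prod b hb, Finset.prod_congr rfl fun i _ => hterm i,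
    Finset.prod_mul_distrib, Finset.prod_ite, Finset.prod_const, Finset.prod_const_one, mul_one,
    ← Fintype.card_subtype, ← rank_eq_card_of_isOrtho b hb, hodd.neg_one_pow, neg_one_mul]

end CharacterSums

/-! ### Common isotropic vectors and constant rank subspaces. -/

/-- The vectors that are isotropic for every form in `N`. -/
def commonIsotropic (N : Submodule K (LinearMap.BilinForm K V)) : Set V :=
  {v | ∀ f ∈ N, f v v = 0}

/-- Counting common isotropic vectors of a space of symmetric forms of odd rank. -/
theorem card_mul_ncard_commonIsotropic [Finite K] [FiniteDimensional K V]
    (hK : Odd (Nat.card K)) {N : Submodule K (LinearMap.BilinForm K V)} (hN : N ≤ Symm K V)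
    (hodd : ∀ f ∈ N, f ≠ 0 → Odd (rank f)) :
    Nat.card N * (commonIsotropic N).ncard = Nat.card V := by
  classical
  have := Fintype.ofFinite K
  have : Finite V := Module.finite_of_finite K
  have := Fintype.ofFinite V
  have : Finite N := Module.finite_of_finite K
  have := Fintype.ofFinite N
  have hK2 : ringChar K ≠ 2 := by
    rw [Ne, FiniteField.even_card_iff_char_two, ← Nat.card_eq_fintype_card]
    have := Nat.odd_iff.mp hK
    omega
  obtain ⟨ε, hε⟩ := FiniteField.exists_nonsquare hK2
  have hε0 : ε ≠ 0 := by rintro rfl; exact hε IsSquare.zero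
  obtain ⟨ψ, hψ⟩ := AddChar.exists_apply_ne_zero.mpr (one_ne_zero (α := K))
  have hsum : ∑ f ∈ (Finset.univ : Finset N).erase 0, expSum ψ (f : LinearMap.BilinForm K V)
      = 0 := by
    -- `f ↦ ε • f` permutes the nonzero forms and negates each exponential sum.
    have h : ∑ f ∈ (Finset.univ : Finset N).erase 0, expSum ψ (f : LinearMap.BilinForm K V) =
        ∑ f ∈ (Finset.univ : Finset N).erase 0, -expSum ψ (f : LinearMap.BilinForm K V) := by
      symm
      refine Finset.sum_bij (fun f _ => ε • f) (fun f hf => ?_) (fun f _ g _ hfg => ?_)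
        (fun f hf => ⟨ε⁻¹ • f, ?_, ?_⟩) (fun f hf => ?_)
      · simpa [hε0] using hf
      · exact smul_right_injective _ hε0 hfg
      · simpa [hε0] using hf
      · simp [hε0]
      · exact (expSum_nonsquare_smul hK2 hψ hε (hN f.2)
          (hodd f f.2 (by simpa using hf))).symm
    rw [Finset.sum_neg_distrib] at h
    exact self_eq_neg.mp h
  have hrow : ∀ v : V, ∑ f : N, ψ ((f : LinearMap.BilinForm K V) v v) =
      if v ∈ commonIsotropic N then (Fintype.card N : ℂ) else 0 := by
    intro v
    split_ifs with h
    · simp [h _ (Subtype.prop _)]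
    · simp only [commonIsotropic, Set.mem_ofPred_eq, not_forall] at h
      obtain ⟨g, hg, hgv⟩ := h
      refine sum_char_comp_eq_zero hψ
        (φ := ((LinearMap.applyₗ v).comp (LinearMap.applyₗ v)).comp N.subtype) fun h => hgv ?_
      simpa using LinearMap.congr_fun h ⟨g, hg⟩
  -- Only the zero form contributes; exchanging the two summations then counts the common isotropic
  -- vectors.
  have htot : ∑ f : N, expSum ψ (f : LinearMap.BilinForm K V) = Fintype.card V := by
    rw [← Finset.add_sum_erase _ _ (Finset.mem_univ (0 : N)), hsum]
    simp [expSum]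
  simp only [expSum] at htot
  rw [Finset.sum_comm, Finset.sum_congr rfl fun v _ => hrow v, Finset.sum_ite,
    Finset.sum_const, Finset.sum_const_zero, add_zero, nsmul_eq_mul] at htot
  rw [Nat.card_eq_fintype_card, Nat.card_eq_fintype_card, mul_comm, Set.ncard_eq_toFinset_card']
  rw [show (commonIsotropic N).toFinset = Finset.univ.filter (· ∈ commonIsotropic N) by ext; simp]
  exact_mod_cast htot

/-- A space of dimension at least `r` of symmetric forms of constant odd rank `r` on a space of
dimension `2 r` has dimension `r` and all its nonzero elements share one radical. -/
theorem finrank_eq_and_rad_eq [Finite K] [FiniteDimensional K V] {r : ℕ} (hr : Odd r)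
    (hV : finrank K V = 2 * r) (hq : Odd (Nat.card K)) (hqr : r + 1 ≤ Nat.card K)
    {N : Submodule K (LinearMap.BilinForm K V)} (hN : N ≤ Symm K V)
    (hrank : ∀ f ∈ N, f ≠ 0 → rank f = r) (hdim : r ≤ finrank K N) :
    finrank K N = r ∧ ∀ f ∈ N, f ≠ 0 → (rad f : Set V) = commonIsotropic N := by
  have hr0 : 0 < r := hr.pos
  have : Finite V := Module.finite_of_finite K
  have hq1 : 1 < Nat.card K := by omega
  have hcount := card_mul_ncard_commonIsotropic hq hN fun f hf h0 => (hrank f hf h0).symm ▸ hr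
  rw [natCard_eq_pow_finrank_of_monoid (K := K), natCard_eq_pow_finrank (K := K) (V := V), hV] at hcount
  have hle : ∀ f ∈ N, rank f ≤ r := by
    intro f hf
    rcases eq_or_ne f 0 with rfl | h0
    · rw [rank_zero]; omega
    · exact (hrank f hf h0).le
  have hsub : ∀ f ∈ N, f ≠ 0 → (rad f : Set V) ⊆ commonIsotropic N := by
    intro f hf h0 u hu g hg
    have hfr := hrank f hf h0
    refine apply_self_eq_zero_of_mem_rad (hN hf) (hN hg) (by omega) (by omega)
      (by rw [hfr]; exact hle g hg) (fun t => ?_) hu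
    rw [hfr]
    exact hle _ (N.add_mem (N.smul_mem t hg) hf)
  have hcard : ∀ f ∈ N, f ≠ 0 → (rad f : Set V).ncard = Nat.card K ^ r := by
    intro f hf h0
    have := rank_add_finrank_rad f
    rw [hrank f hf h0, hV] at this
    rw [← Nat.card_coe_set_eq]
    refine (natCard_eq_pow_finrank (K := K) (V := rad f)).trans ?_
    congr 1
    omega
  have hNbot : N ≠ ⊥ := by
    rintro rfl
    simp at hdim
    omega
  obtain ⟨f₀, hf₀, hf₀0⟩ := N.exists_mem_ne_zero_of_ne_bot hNbot
  have hlow := Set.ncard_le_ncard (hsub f₀ hf₀ hf₀0)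
  rw [hcard f₀ hf₀ hf₀0] at hlow
  have hpow : Nat.card K ^ (finrank K N + r) ≤ Nat.card K ^ (2 * r) := by
    rw [← hcount, pow_add]
    exact Nat.mul_le_mul_left _ hlow
  have hdimN : finrank K N = r := by
    have := (Nat.pow_le_pow_iff_right hq1).mp hpow
    omega
  refine ⟨hdimN, fun f hf h0 => Set.eq_of_subset_of_ncard_le (hsub f hf h0) ?_⟩
  rw [hcard f hf h0]
  rw [hdimN, two_mul, pow_add] at hcount
  exact (Nat.eq_of_mul_eq_mul_left (by positivity) hcount).le

/-- Rank-nullity for `f ↦ f u`, a map from `M` to the dual of `V` with kernel `sub M u`. -/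
theorem finrank_le_finrank_add_finrank_sub [FiniteDimensional K V]
    (M : Submodule K (LinearMap.BilinForm K V)) (u : V) :
    finrank K M ≤ finrank K V + finrank K (sub M u) := by
  let φ : M →ₗ[K] V →ₗ[K] K := (LinearMap.applyₗ u).comp M.subtype
  have hmap : (LinearMap.ker φ).map M.subtype = sub M u := by
    ext f
    simp only [Submodule.mem_map, LinearMap.mem_ker, Submodule.subtype_apply, Subtype.exists,
      mem_sub, mem_rad]
    constructor
    · rintro ⟨g, hg, h0, rfl⟩
      exact ⟨hg, fun v => LinearMap.congr_fun h0 v⟩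
    · rintro ⟨hf, h0⟩
      exact ⟨f, hf, LinearMap.ext h0, rfl⟩
  have hker : finrank K (LinearMap.ker φ) = finrank K (sub M u) := by
    rw [← hmap]
    exact (Submodule.equivMapOfInjective _ M.injective_subtype _).finrank_eq
  have hrange : finrank K (LinearMap.range φ) ≤ finrank K V := by
    rw [← Subspace.dual_finrank_eq (K := K) (V := V)]
    exact Submodule.finrank_le _
  have := finrank_range_add_finrank_ker_of_monoid φ
  omega

theorem rank_lt_of_mem_rad [FiniteDimensional K V] {f : LinearMap.BilinForm K V} {u : V}
    (hu : u ≠ 0) (hf : u ∈ rad f) : rank f < finrank K V := by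
  have : 0 < finrank K (rad f) := by
    have : Nontrivial (rad f) := ⟨⟨u, hf⟩, 0, by simpa using hu⟩
    exact finrank_pos
  have := rank_add_finrank_rad f
  omega

/-! ### Spreads and the geometry of the common radicals. -/

/-- A spread of `r`-dimensional subspaces of a `2 r`-dimensional space has `q ^ r + 1` members. -/
theorem IsSpread.ncard_eq [Finite K] [FiniteDimensional K V] {r : ℕ} (hr : 0 < r)
    (hV : finrank K V = 2 * r) {S : Set (Submodule K V)} (hS : IsSpread r S) :
    S.ncard = Nat.card K ^ r + 1 := by
  classical
  obtain ⟨hdim, hdisj, hcov⟩ := hS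
  have : Finite V := Module.finite_of_finite K
  have := Fintype.ofFinite V
  have : Finite (Submodule K V) := Finite.of_injective _ SetLike.coe_injective
  have := Fintype.ofFinite (Submodule K V)
  choose P hPS hP using hcov
  have hq : 1 < Nat.card K ^ r := Nat.one_lt_pow hr.ne' Finite.one_lt_card
  -- The nonzero vectors are counted by the unique member of the spread containing each.
  have hfib : ∀ U ∈ S.toFinset,
      ((Finset.univ.erase (0 : V)).filter fun v => P v = U).card = Nat.card K ^ r - 1 := by
    intro U hU
    rw [Set.mem_toFinset] at hU
    have hEq : ((Finset.univ.erase (0 : V)).filter fun v => P v = U) =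
        (Finset.univ.filter (· ∈ U)).erase 0 := by
      ext v
      simp only [Finset.mem_filter, Finset.mem_erase, Finset.mem_univ, and_true, true_and]
      refine and_congr_right fun hv => ⟨fun h => h ▸ hP v, fun h => ?_⟩
      by_contra hne
      have hb := hdisj _ (hPS v) _ hU hne
      exact hv ((Submodule.mem_bot K).mp (hb ▸ ⟨hP v, h⟩))
    rw [hEq, Finset.card_erase_of_mem (by simp), ← hdim U hU,
      ← natCard_eq_pow_finrank (K := K) (V := U), Nat.card_eq_fintype_card,
      Fintype.card_subtype]
  have hcount := Finset.card_eq_sum_card_fiberwise (f := P) (s := Finset.univ.erase (0 : V))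
    (t := S.toFinset) (fun v _ => by simpa using hPS v)
  rw [Finset.sum_congr rfl hfib, Finset.sum_const, smul_eq_mul,
    Finset.card_erase_of_mem (Finset.mem_univ _), Finset.card_univ, ← Nat.card_eq_fintype_card,
    natCard_eq_pow_finrank (K := K) (V := V), hV, ← Set.ncard_eq_toFinset_card'] at hcount
  have hsq : Nat.card K ^ (2 * r) - 1 = (Nat.card K ^ r + 1) * (Nat.card K ^ r - 1) := by
    rw [mul_comm 2 r, pow_mul, ← Nat.sq_sub_sq, one_pow]
  rw [hsq] at hcount
  exact (Nat.eq_of_mul_eq_mul_right (by omega) hcount).symm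

/-- Each `sub M u` has dimension `r`, and `U u` is the common radical, of dimension `r`, of its
nonzero elements. -/
structure HasCommonRadicals (r : ℕ) (M : Submodule K (LinearMap.BilinForm K V))
    (U : V → Submodule K V) : Prop where
  pos : 0 < r
  finrank_sub : ∀ {u}, u ≠ 0 → finrank K (sub M u) = r
  finrank_rad : ∀ {u}, u ≠ 0 → finrank K (U u) = r
  rad_eq : ∀ {u}, u ≠ 0 → ∀ {f}, f ∈ sub M u → f ≠ 0 → rad f = U u

namespace HasCommonRadicals

variable {r : ℕ} {M : Submodule K (LinearMap.BilinForm K V)} {U : V → Submodule K V} {u w x : V}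

theorem exists_ne_zero (h : HasCommonRadicals r M U) (hu : u ≠ 0) : ∃ f ∈ sub M u, f ≠ 0 := by
  refine Submodule.exists_mem_ne_zero_of_ne_bot fun hb => ?_
  have h1 := h.finrank_sub hu
  rw [hb, finrank_bot] at h1
  exact h.pos.ne h1

theorem mem_self (h : HasCommonRadicals r M U) (hu : u ≠ 0) : u ∈ U u := by
  obtain ⟨f, hf, hf0⟩ := h.exists_ne_zero hu
  exact h.rad_eq hu hf hf0 ▸ hf.2

/-- A nonzero `f` in `sub M u` has `x` in its radical, so it also lies in `sub M x` and determines
both radicals. -/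
theorem eq_of_mem (h : HasCommonRadicals r M U) (hu : u ≠ 0) (hx : x ≠ 0) (hxu : x ∈ U u) :
    U x = U u := by
  obtain ⟨f, hf, hf0⟩ := h.exists_ne_zero hu
  rw [← h.rad_eq hu hf hf0] at hxu ⊢
  exact (h.rad_eq hx ⟨hf.1, hxu⟩ hf0).symm

theorem sub_le_sub (h : HasCommonRadicals r M U) (hu : u ≠ 0) (hw : w ≠ 0) (he : U u = U w) :
    sub M u ≤ sub M w := by
  intro f hf
  rcases eq_or_ne f 0 with rfl | hf0
  · exact zero_mem _
  · exact ⟨hf.1, by rw [h.rad_eq hu hf hf0, he]; exact h.mem_self hw⟩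

theorem sub_eq_sub_iff (h : HasCommonRadicals r M U) (hu : u ≠ 0) (hw : w ≠ 0) :
    sub M u = sub M w ↔ U u = U w := by
  refine ⟨fun he => ?_, fun he =>
    le_antisymm (h.sub_le_sub hu hw he) (h.sub_le_sub hw hu he.symm)⟩
  obtain ⟨f, hf, hf0⟩ := h.exists_ne_zero hu
  rw [← h.rad_eq hu hf hf0, ← h.rad_eq hw (he ▸ hf) hf0]

theorem sub_inf_sub (h : HasCommonRadicals r M U) (hu : u ≠ 0) (hw : w ≠ 0)
    (hne : sub M u ≠ sub M w) : sub M u ⊓ sub M w = ⊥ := by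
  rw [Submodule.eq_bot_iff]
  rintro f ⟨hfu, hfw⟩
  by_contra hf0
  exact hne ((h.sub_eq_sub_iff hu hw).mpr
    ((h.rad_eq hu hfu hf0).symm.trans (h.rad_eq hw hfw hf0)))

theorem rad_inf_rad (h : HasCommonRadicals r M U) (hu : u ≠ 0) (hw : w ≠ 0)
    (hne : U u ≠ U w) : U u ⊓ U w = ⊥ := by
  rw [Submodule.eq_bot_iff]
  rintro x ⟨hxu, hxw⟩
  by_contra hx
  exact hne ((h.eq_of_mem hu hx hxu).symm.trans (h.eq_of_mem hw hx hxw))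

theorem mem_radicals_iff (h : HasCommonRadicals r M U) {W : Submodule K V} :
    W ∈ radicals M ↔ ∃ u, u ≠ 0 ∧ W = U u := by
  constructor
  · rintro ⟨u, hu, f, hf, hf0, rfl⟩
    exact ⟨u, hu, h.rad_eq hu hf hf0⟩
  · rintro ⟨u, hu, rfl⟩
    obtain ⟨f, hf, hf0⟩ := h.exists_ne_zero hu
    exact ⟨u, hu, f, hf, hf0, (h.rad_eq hu hf hf0).symm⟩

theorem isSpread (h : HasCommonRadicals r M U) [Nontrivial V] : IsSpread r (radicals M) := by
  refine ⟨fun W hW => ?_, fun W hW W' hW' hne => ?_, fun v => ?_⟩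
  · obtain ⟨u, hu, rfl⟩ := h.mem_radicals_iff.mp hW
    exact h.finrank_rad hu
  · obtain ⟨u, hu, rfl⟩ := h.mem_radicals_iff.mp hW
    obtain ⟨w, hw, rfl⟩ := h.mem_radicals_iff.mp hW'
    exact h.rad_inf_rad hu hw hne
  · rcases eq_or_ne v 0 with rfl | hv
    · obtain ⟨u, hu⟩ := exists_ne (0 : V)
      exact ⟨U u, h.mem_radicals_iff.mpr ⟨u, hu, rfl⟩, zero_mem _⟩
    · exact ⟨U v, h.mem_radicals_iff.mpr ⟨v, hv, rfl⟩, h.mem_self hv⟩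

theorem ncard_subs (h : HasCommonRadicals r M U) : (subs M).ncard = (radicals M).ncard := by
  refine Set.ncard_congr (fun N hN => U (Classical.choose hN)) (fun N hN => ?_)
    (fun N N' hN hN' he => ?_) (fun W hW => ?_)
  · exact h.mem_radicals_iff.mpr ⟨_, (Classical.choose_spec hN).1, rfl⟩
  · have h1 := Classical.choose_spec hN
    have h2 := Classical.choose_spec hN'
    rw [h1.2, h2.2]
    exact (h.sub_eq_sub_iff h1.1 h2.1).mpr he
  · obtain ⟨u, hu, rfl⟩ := h.mem_radicals_iff.mp hW
    have hN : sub M u ∈ subs M := ⟨u, hu, rfl⟩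
    have h1 := Classical.choose_spec hN
    exact ⟨sub M u, hN, (h.sub_eq_sub_iff h1.1 hu).mp h1.2.symm⟩

/-- If both components of `f` are nonzero, their radicals are complementary in `V`, and `f` is
nondegenerate, of rank `2 r`. -/
theorem mem_or_mem_of_rank_eq [FiniteDimensional K V] (h : HasCommonRadicals r M U)
    (hV : finrank K V = 2 * r) (hM : M ≤ Symm K V) (hu : u ≠ 0) (hw : w ≠ 0)
    (hne : sub M u ≠ sub M w) {f : LinearMap.BilinForm K V} (hf : f ∈ sub M u ⊔ sub M w)
    (hfr : rank f = r) : f ∈ sub M u ∨ f ∈ sub M w := by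
  obtain ⟨g, hg, k, hk, rfl⟩ := Submodule.mem_sup.mp hf
  by_contra hcon
  rw [not_or] at hcon
  have hg0 : g ≠ 0 := by
    rintro rfl
    exact hcon.2 (by simpa using hk)
  have hk0 : k ≠ 0 := by
    rintro rfl
    exact hcon.1 (by simpa using hg)
  have hinf := h.rad_inf_rad hu hw (mt (h.sub_eq_sub_iff hu hw).mpr hne)
  have htop : U u ⊔ U w = ⊤ := by
    apply Submodule.eq_top_of_finrank_eq
    rw [finrank_sup_of_monoid hinf, h.finrank_rad hu, h.finrank_rad hw, hV, two_mul]
  have hgU : ∀ a ∈ U u, ∀ v, g a v = 0 := fun a ha => by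
    rwa [← h.rad_eq hu hg hg0] at ha
  have hkU : ∀ a ∈ U w, ∀ v, k a v = 0 := fun a ha => by
    rwa [← h.rad_eq hw hk hk0] at ha
  have hgs : g.IsSymm := hM hg.1
  have hks : k.IsSymm := hM hk.1
  have hrad : rad (g + k) = ⊥ := by
    rw [Submodule.eq_bot_iff]
    intro y hy
    obtain ⟨a, ha, b, hb, rfl⟩ := Submodule.mem_sup.mp (htop ▸ Submodule.mem_top (x := y))
    have hsum : ∀ v, k a v + g b v = 0 := fun v => by
      have := hy v
      simpa [hgU a ha, hkU b hb, add_comm] using this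
    -- Testing against `c` in `U u`, where `g` vanishes, gives `k a c = 0`; on `U w` the form `k`
    -- vanishes anyway.
    have hka : a ∈ rad k := fun v => by
      obtain ⟨c, hc, d, hd, rfl⟩ := Submodule.mem_sup.mp (htop ▸ Submodule.mem_top (x := v))
      have := hsum c
      rw [hgs.eq b c, hgU c hc, add_zero] at this
      rw [map_add, this, hks.eq a d, hkU d hd, add_zero]
    have hgb : b ∈ rad g := fun v => by simpa [hka v] using hsum v
    rw [h.rad_eq hw hk hk0] at hka
    rw [h.rad_eq hu hg hg0] at hgb
    have ha0 : a ∈ U u ⊓ U w := ⟨ha, hka⟩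
    have hb0 : b ∈ U u ⊓ U w := ⟨hgb, hb⟩
    rw [hinf, Submodule.mem_bot] at ha0 hb0
    rw [ha0, hb0, add_zero]
  have hrank := rank_add_finrank_rad (g + k)
  rw [hrad, finrank_bot] at hrank
  have := h.pos
  omega

theorem sup_inf_sub [FiniteDimensional K V] (h : HasCommonRadicals r M U)
    (hV : finrank K V = 2 * r) (hM : M ≤ Symm K V) (hu : u ≠ 0) (hw : w ≠ 0) (hx : x ≠ 0)
    (huw : sub M u ≠ sub M w) (hux : sub M u ≠ sub M x) (hwx : sub M w ≠ sub M x) :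
    (sub M u ⊔ sub M w) ⊓ sub M x = ⊥ := by
  rw [Submodule.eq_bot_iff]
  rintro f ⟨hf, hfx⟩
  by_contra hf0
  have hrank : rank f = r := by
    have := rank_add_finrank_rad f
    rw [h.rad_eq hx hfx hf0, h.finrank_rad hx] at this
    omega
  rcases h.mem_or_mem_of_rank_eq hV hM hu hw huw hf hrank with hfu | hfw
  · exact hf0 ((Submodule.mem_bot K).mp (h.sub_inf_sub hu hx hux ▸ ⟨hfu, hfx⟩))
  · exact hf0 ((Submodule.mem_bot K).mp (h.sub_inf_sub hw hx hwx ▸ ⟨hfw, hfx⟩))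

end HasCommonRadicals

theorem sub_le (M : Submodule K (LinearMap.BilinForm K V)) (u : V) : sub M u ≤ M :=
  fun _ hf => hf.1

end SymmForms

/-! ### Assembly of the main theorem. -/

open SymmForms in
theorem mainTheorem6 {K V : Type*} [Field K] [Finite K] [AddCommGroup V] [Module K V]
    [FiniteDimensional K V] (r : ℕ) (hr : Odd r) (hV : Module.finrank K V = 2 * r)
    (hq : Odd (Nat.card K)) (hqr : r + 1 ≤ Nat.card K)
    (M : Submodule K (LinearMap.BilinForm K V)) (hM : M ≤ SymmForms.Symm K V)
    (hdim : Module.finrank K M = 3 * r)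
    (hrank : ∀ f ∈ M, f ≠ 0 → SymmForms.rank f = r ∨ SymmForms.rank f = 2 * r) :
    -- each `M_u` is an `r`-dimensional constant rank `r` subspace with one common radical
    (∀ u : V, u ≠ 0 →
      Module.finrank K (SymmForms.sub M u) = r ∧
      SymmForms.IsConstantRank r (SymmForms.sub M u) ∧
      ∃ U : Submodule K V, Module.finrank K U = r ∧
        ∀ f ∈ SymmForms.sub M u, f ≠ 0 → SymmForms.rad f = U) ∧
    -- two subspaces `M_u`, `M_w` are identical or intersect trivially
    (∀ u w : V, u ≠ 0 → w ≠ 0 →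
      SymmForms.sub M u = SymmForms.sub M w ∨
      SymmForms.sub M u ⊓ SymmForms.sub M w = ⊥) ∧
    -- the radicals form a spread of `q ^ r + 1` subspaces
    SymmForms.IsSpread r (SymmForms.radicals M) ∧
    (SymmForms.radicals M).ncard = Nat.card K ^ r + 1 ∧
    -- there are `q ^ r + 1` different subspaces `M_u`
    (SymmForms.subs M).ncard = Nat.card K ^ r + 1 ∧
    -- they are exactly the `r`-dimensional constant rank `r` subspaces of `M`
    (∀ N : Submodule K (LinearMap.BilinForm K V),
      N ∈ SymmForms.subs M ↔
        N ≤ M ∧ Module.finrank K N = r ∧ SymmForms.IsConstantRank r N) ∧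
    -- for `M_u ≠ M_w`, the sum is direct, of dimension `2 r`, and has no further rank `r` elements
    (∀ u w : V, u ≠ 0 → w ≠ 0 → SymmForms.sub M u ≠ SymmForms.sub M w →
      SymmForms.sub M u ⊓ SymmForms.sub M w = ⊥ ∧
      Module.finrank K ↥(SymmForms.sub M u ⊔ SymmForms.sub M w) = 2 * r ∧
      (∀ f ∈ SymmForms.sub M u ⊔ SymmForms.sub M w, SymmForms.rank f = r →
        f ∈ SymmForms.sub M u ∨ f ∈ SymmForms.sub M w) ∧
      -- any third such subspace completes them to a direct decomposition of `M`
      ∀ N : Submodule K (LinearMap.BilinForm K V), N ≤ M → Module.finrank K N = r →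
        SymmForms.IsConstantRank r N → N ≠ SymmForms.sub M u → N ≠ SymmForms.sub M w →
        (SymmForms.sub M u ⊔ SymmForms.sub M w) ⊓ N = ⊥ ∧
        iSupIndep ![SymmForms.sub M u, SymmForms.sub M w, N] ∧
        SymmForms.sub M u ⊔ SymmForms.sub M w ⊔ N = M) := by
  have hr0 : 0 < r := hr.pos
  have : Nontrivial V := nontrivial_of_finrank_pos (R := K) (by omega)
  have hconst : ∀ u : V, u ≠ 0 → ∀ f ∈ sub M u, f ≠ 0 → rank f = r := fun u hu f hf hf0 => by
    have := rank_lt_of_mem_rad hu hf.2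
    rcases hrank f hf.1 hf0 with h | h <;> omega
  have hcommon : ∀ u : V, u ≠ 0 → finrank K (sub M u) = r ∧
      ∀ f ∈ sub M u, f ≠ 0 → (rad f : Set V) = commonIsotropic (sub M u) := fun u hu =>
    finrank_eq_and_rad_eq hr hV hq hqr ((sub_le M u).trans hM) (hconst u hu) (by
      have := finrank_le_finrank_add_finrank_sub M u
      omega)
  have hexists : ∀ u : V, ∃ W : Submodule K V, u ≠ 0 → finrank K W = r ∧
      ∀ f ∈ sub M u, f ≠ 0 → rad f = W := fun u => by
    by_cases hu : u = 0
    · exact ⟨⊥, fun h => (h hu).elim⟩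
    obtain ⟨h1, h2⟩ := hcommon u hu
    have hb : sub M u ≠ ⊥ := fun hb => by
      rw [hb, finrank_bot] at h1
      omega
    obtain ⟨f, hf, hf0⟩ := Submodule.exists_mem_ne_zero_of_ne_bot hb
    refine ⟨rad f, fun _ => ⟨?_, fun g hg hg0 => ?_⟩⟩
    · have := rank_add_finrank_rad f
      have := hconst u hu f hf hf0
      omega
    · exact SetLike.coe_injective ((h2 g hg hg0).trans (h2 f hf hf0).symm)
  choose U hU using hexists
  have h : HasCommonRadicals r M U :=
    { pos := hr0
      finrank_sub := fun hu => (hcommon _ hu).1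
      finrank_rad := fun hu => (hU _ hu).1
      rad_eq := fun hu _ hf hf0 => (hU _ hu).2 _ hf hf0 }
  have hne_bot : ∀ u : V, u ≠ 0 → sub M u ≠ ⊥ := fun u hu => by
    obtain ⟨f, hf, hf0⟩ := h.exists_ne_zero hu
    exact (Submodule.ne_bot_iff _).mpr ⟨f, hf, hf0⟩
  have hchar : ∀ N : Submodule K (LinearMap.BilinForm K V),
      N ∈ subs M ↔ N ≤ M ∧ finrank K N = r ∧ IsConstantRank r N := by
    refine fun N => ⟨?_, ?_⟩
    · rintro ⟨u, hu, rfl⟩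
      exact ⟨sub_le M u, h.finrank_sub hu, hne_bot u hu, hconst u hu⟩
    · rintro ⟨hNM, hNr, hNb, hNc⟩
      -- `N` itself has a common radical; any nonzero `u` in it gives `N ≤ sub M u`, and the
      -- dimensions agree.
      obtain ⟨-, h2⟩ := finrank_eq_and_rad_eq hr hV hq hqr (hNM.trans hM) hNc hNr.ge
      obtain ⟨f, hf, hf0⟩ := Submodule.exists_mem_ne_zero_of_ne_bot hNb
      have hfb : rad f ≠ ⊥ := fun hb => by
        have := rank_add_finrank_rad f
        rw [hb, finrank_bot, hNc f hf hf0] at this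
        omega
      obtain ⟨u, huf, hu⟩ := Submodule.exists_mem_ne_zero_of_ne_bot hfb
      refine ⟨u, hu, eq_of_le_of_finrank_le_of_monoid (fun g hg => ?_)
        (by rw [h.finrank_sub hu, hNr])⟩
      rcases eq_or_ne g 0 with rfl | hg0
      · exact zero_mem _
      · exact ⟨hNM hg, SetLike.coe_injective ((h2 f hf hf0).trans (h2 g hg hg0).symm) ▸ huf⟩
  have hspread := h.isSpread
  have hcard := hspread.ncard_eq hr0 hV
  refine ⟨fun u hu => ⟨h.finrank_sub hu, ⟨hne_bot u hu, hconst u hu⟩, U u, hU u hu⟩,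
    fun u w hu hw => or_iff_not_imp_left.mpr (h.sub_inf_sub hu hw), hspread, hcard,
    h.ncard_subs.trans hcard, hchar, fun u w hu hw huw => ?_⟩
  have hinf := h.sub_inf_sub hu hw huw
  have hsup : finrank K ↥(sub M u ⊔ sub M w) = 2 * r := by
    rw [finrank_sup_of_monoid hinf, h.finrank_sub hu, h.finrank_sub hw, two_mul]
  refine ⟨hinf, hsup, fun f hf hfr => h.mem_or_mem_of_rank_eq hV hM hu hw huw hf hfr,
    fun N hNM hNr hNc hNu hNw => ?_⟩
  obtain ⟨x, hx, rfl⟩ := (hchar N).mpr ⟨hNM, hNr, hNc⟩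
  have htriple := h.sup_inf_sub hV hM hu hw hx huw hNu.symm hNw.symm
  refine ⟨htriple, ?_, ?_⟩
  · rw [iSupIndep_fin_three]
    simp only [Matrix.cons_val, disjoint_iff]
    refine ⟨?_, ?_, ?_⟩
    · rw [inf_comm]
      exact h.sup_inf_sub hV hM hw hx hu hNw.symm huw.symm hNu
    · rw [inf_comm]
      exact h.sup_inf_sub hV hM hx hu hw hNu hNw huw
    · rw [inf_comm]
      exact htriple
  · refine eq_of_le_of_finrank_le_of_monoid
      (sup_le (sup_le (sub_le M u) (sub_le M w)) hNM) ?_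
    rw [finrank_sup_of_monoid htriple, hsup, hNr, hdim]
    omega
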